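/- Let $(M,g)$ be a smooth Riemannian manifold of dimension $m$ (without boundary) with Levi-Civita connection $\nabla$, let $f_1,f_2>0$ be real constants, and let $\pi:TM\to M$ be the tangent bundle. Let $TTM=H\oplus V$ be the splitting into the vertical distribution $V=\ker d\pi$ and the horizontal distribution $H$ of $\nabla$, both identified with $\pi^*TM$ in the canonical way, and let $G=g^{f_1,f_2}=f_1\,\pi^*g\oplus f_2\,\pi^*g$ on $H\oplus V$; that is, $$G(\xi,\zeta)=f_1\,g(d\pi\,\xi,d\pi\,\zeta)+f_2\,g(K\xi,K\zeta),$$ where $K:TTM\to TM$ is the connection map of $\nabla$, given in induced coordinates $(x^i,u^i)$ by $K(\dot x,\dot u)^i=\dot u^i+\Gamma^i_{jk}u^j\dot x^k$. Then the following three conditions are equivalent: 1. the Riemannian manifold $(TM,G)$ is Einstein, i.e. there is a constant $c\in\mathbb R$ with $\mathrm{ric}^G=c\,G$ on $TM$; 2. $(TM,G)$ is flat, i.e. its Riemannian curvature tensor vanishes identically; 3. $(M,g)$ is flat, i.e. its Riemannian curvature tensor vanishes identically. -/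

import Mathlib

open scoped Manifold ContDiff
open Bundle

noncomputable section

namespace TangentBundleMetric

/-! ### Riemannian geometry in one chart

`h : E → E →L[ℝ] E →L[ℝ] ℝ` is the expression of a Riemannian metric in a chart with values in `E`:
`h y v w` is the inner product of the tangent vectors with components `v`, `w` at the point with
coordinates `y`. The formulas are the classical ones, written without indices. -/

section Chart

variable {E : Type*} [NormedAddCommGroup E] [NormedSpace ℝ E]

/-- Christoffel symbols of the first kind,
`Γ(v, w; z) = 1/2 (D_v h(w, z) + D_w h(v, z) - D_z h(v, w))`. -/
def christoffelFirst (h : E → E →L[ℝ] E →L[ℝ] ℝ) (y v : E) : E →L[ℝ] E →L[ℝ] ℝ :=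
  (1 / 2 : ℝ) •
    (fderiv ℝ h y v + (fderiv ℝ h y).flip v - ((fderiv ℝ h y).flip v).flip)

theorem christoffelFirst_apply (h : E → E →L[ℝ] E →L[ℝ] ℝ) (y v w z : E) :
    christoffelFirst h y v w z =
      (1 / 2 : ℝ) * (fderiv ℝ h y v w z + fderiv ℝ h y w v z - fderiv ℝ h y z v w) := rfl

/-- Christoffel symbols of the Levi-Civita connection: `christoffel h y v w` is the vector `Γ(v, w)`
with `h(Γ(v, w), z) = Γ(v, w; z)` for all `z`, so that `∇_v W = D_v W + Γ(v, W)`.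
(`ContinuousLinearMap.inverse (h y)` is the inverse of the isomorphism `h y` from `E` to its dual.) -/
def christoffel (h : E → E →L[ℝ] E →L[ℝ] ℝ) (y v : E) : E →L[ℝ] E :=
  ContinuousLinearMap.inverse (h y) ∘L christoffelFirst h y v

theorem christoffel_spec {h : E → E →L[ℝ] E →L[ℝ] ℝ} {y : E} (hy : (h y).IsInvertible)
    (v w z : E) : h y (christoffel h y v w) z = christoffelFirst h y v w z := by
  obtain ⟨e, he⟩ := hy
  simp [christoffel, ← he]

/-- The curvature tensor `R(v, w) z = ∇_v ∇_w z - ∇_w ∇_v z` of the Levi-Civita connection, where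
`v`, `w`, `z` are extended as constant vector fields of the chart. -/
def curvature (h : E → E →L[ℝ] E →L[ℝ] ℝ) (y v w z : E) : E :=
  fderiv ℝ (fun y' => christoffel h y' w z) y v - fderiv ℝ (fun y' => christoffel h y' v z) y w
    + christoffel h y v (christoffel h y w z) - christoffel h y w (christoffel h y v z)

/-- The Ricci tensor: `ric(w, z)` is the trace of `v ↦ R(v, w) z`, computed in a basis of `E`. -/
def ricci [FiniteDimensional ℝ E] (h : E → E →L[ℝ] E →L[ℝ] ℝ) (y w z : E) : ℝ :=
  ∑ i, (Module.finBasis ℝ E).coord i (curvature h y (Module.finBasis ℝ E i) w z)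

end Chart

/-! ### Riemannian geometry of a manifold

A metric `g` on a manifold `N` without boundary is studied through its expressions in the charts
`extChartAt I q`, `q : N`, which cover `N`. -/

section Manifold

variable {E : Type*} [NormedAddCommGroup E] [NormedSpace ℝ E]
  {H : Type*} [TopologicalSpace H] (I : ModelWithCorners ℝ E H)
  {N : Type*} [TopologicalSpace N] [ChartedSpace H N]

/-- The expression of a metric `g` in the chart around `q`, that is, its pullback under the inverse
of that chart. -/
def localMetric (g : ∀ x : N, TangentSpace I x →L[ℝ] TangentSpace I x →L[ℝ] ℝ) (q : N) (y : E) :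
    E →L[ℝ] E →L[ℝ] ℝ :=
  let D : E →L[ℝ] TangentSpace I ((extChartAt I q).symm y) :=
    mfderiv 𝓘(ℝ, E) I (extChartAt I q).symm y
  (ContinuousLinearMap.precomp ℝ D) ∘L (g ((extChartAt I q).symm y)) ∘L D

theorem localMetric_apply (g : ∀ x : N, TangentSpace I x →L[ℝ] TangentSpace I x →L[ℝ] ℝ)
    (q : N) (y v w : E) :
    localMetric I g q y v w = g ((extChartAt I q).symm y)
      (mfderiv 𝓘(ℝ, E) I (extChartAt I q).symm y v)
      (mfderiv 𝓘(ℝ, E) I (extChartAt I q).symm y w) := rfl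

/-- The metric is flat: its curvature tensor vanishes everywhere. -/
def IsFlat (g : ∀ x : N, TangentSpace I x →L[ℝ] TangentSpace I x →L[ℝ] ℝ) : Prop :=
  ∀ q : N, ∀ y ∈ (extChartAt I q).target, ∀ v w z : E,
    curvature (localMetric I g q) y v w z = 0

/-- The metric is Einstein: `ric = c g` for a real constant `c`. -/
def IsEinstein [FiniteDimensional ℝ E]
    (g : ∀ x : N, TangentSpace I x →L[ℝ] TangentSpace I x →L[ℝ] ℝ) : Prop :=
  ∃ c : ℝ, ∀ q : N, ∀ y ∈ (extChartAt I q).target, ∀ v w : E,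
    ricci (localMetric I g q) y v w = c * localMetric I g q y v w

end Manifold

/-! ### The weighted Sasaki metric on the tangent bundle -/

section TangentBundle

variable {E : Type*} [NormedAddCommGroup E] [NormedSpace ℝ E]
  {H : Type*} [TopologicalSpace H] (I : ModelWithCorners ℝ E H)
  {M : Type*} [TopologicalSpace M] [ChartedSpace H M] [IsManifold I 1 M]

/-- The differential at `p = (x, u)` of the projection `π : TM → M`. -/
def dProj (p : TangentBundle I M) : TangentSpace I.tangent p →L[ℝ] TangentSpace I p.proj :=
  mfderiv I.tangent I (fun p' : TangentBundle I M => p'.proj) p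

/-- The connection map `K : T_p (TM) → T_x M` at `p = (x, u)` of the Levi-Civita connection of `g`:
in the coordinates `(y, η)` of `TM` induced by the chart of `M` around `x`, it sends the tangent
vector with components `(y', η')` to the tangent vector of `M` with components `η' + Γ(η, y')`.
Its kernel is the horizontal subspace `H_p`; on the vertical subspace `V_p = ker dπ` it is the
canonical isomorphism with `T_x M`. -/
def connectionMap (g : ∀ x : M, TangentSpace I x →L[ℝ] TangentSpace I x →L[ℝ] ℝ)
    (p : TangentBundle I M) : TangentSpace I.tangent p →L[ℝ] TangentSpace I p.proj :=
  let c : E × E := extChartAt I.tangent p p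
  let dcoord : TangentSpace I.tangent p →L[ℝ] E × E :=
    mfderiv I.tangent 𝓘(ℝ, E × E) (extChartAt I.tangent p) p
  let ofComponents : E →L[ℝ] TangentSpace I p.proj :=
    (trivializationAt E (TangentSpace I) p.proj).symmL ℝ p.proj
  ofComponents ∘L
    (ContinuousLinearMap.snd ℝ E E
      + christoffel (localMetric I g p.proj) c.1 c.2 ∘L ContinuousLinearMap.fst ℝ E E)
    ∘L dcoord

/-- The metric `f₁ π^*g ⊕ f₂ π^*g` on `T(TM) = H ⊕ V`, where `H` is the horizontal distribution of
the Levi-Civita connection of `g` and `f₁`, `f₂` are constants: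
`G(ξ, ζ) = f₁ g(dπ ξ, dπ ζ) + f₂ g(K ξ, K ζ)`. -/
def weightedSasaki (g : ∀ x : M, TangentSpace I x →L[ℝ] TangentSpace I x →L[ℝ] ℝ) (f₁ f₂ : ℝ)
    (p : TangentBundle I M) :
    TangentSpace I.tangent p →L[ℝ] TangentSpace I.tangent p →L[ℝ] ℝ :=
  f₁ • (ContinuousLinearMap.precomp ℝ (dProj I p) ∘L g p.proj ∘L dProj I p)
    + f₂ • (ContinuousLinearMap.precomp ℝ (connectionMap I g p) ∘L g p.proj ∘L connectionMap I g p)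

theorem weightedSasaki_apply (g : ∀ x : M, TangentSpace I x →L[ℝ] TangentSpace I x →L[ℝ] ℝ)
    (f₁ f₂ : ℝ) (p : TangentBundle I M) (ξ ζ : TangentSpace I.tangent p) :
    weightedSasaki I g f₁ f₂ p ξ ζ = f₁ * g p.proj (dProj I p ξ) (dProj I p ζ)
      + f₂ * g p.proj (connectionMap I g p ξ) (connectionMap I g p ζ) := rfl

end TangentBundle

end TangentBundleMetric

end

/-!
The implication that carries the theorem is that `M` is flat as soon as `(TM, G)` is Einstein. It
only needs the Ricci curvature of `G` in vertical directions. Work in the coordinates `(y, η)` of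
`TM` induced by a chart of `M`, in which `G` is `sasakiForm`. Let `ξ` be a constant vertical vector
field and let `S = ∇ξ`, an endomorphism field of `TTM`. The Koszul formula
(`IsChartMetric.sasakiForm_christoffel`) shows that `S` kills vertical vectors and that its
horizontal block `T` (`horizontalShape`) is given by `f₁ g(T v, w) = (f₂ / 2) g(ξ, R(v, w) η)`.
Thus `T` is skew-symmetric, because `R(v, w)` is antisymmetric in `v`, `w`; hence `tr S = tr T = 0`
everywhere. As `∇_ξ ξ = 0`, the trace of `A ↦ R(A, ξ) ξ = -(∂_ξ S) A - S (S A)` is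
`ric(ξ, ξ) = - tr S² = - tr T²` (`IsChartMetric.ricci_sasakiForm_vertical`), which is `|T|²`. If
`ric = c G`, then evaluating on the zero section, where `T = 0`, gives `c g(ξ, ξ) = 0`; this number
does not depend on `η`, so that `tr T² = 0` and `T = 0` for all `η` and `ξ`, which means `R = 0`.

Conversely, if `M` is flat, then the identification of `TTM` with `π^*TM ⊕ π^*TM` carries the
Levi-Civita connection of `G` to the pullback of `∇ ⊕ ∇`, whose curvature is the pullback of
`R ⊕ R = 0` (`IsChartMetric.curvature_sasakiForm_eq_zero`). That a flat metric is Einstein is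
immediate.

The connection map at a point is defined by the preferred chart at this point. The transformation
law of the Christoffel symbols (`christoffel_changeOfCharts`) shows that it is given by the same
formula in every induced chart, so that `sasakiForm` is the expression of `G` in each of them
(`localMetric_weightedSasaki`).
-/

namespace TangentBundleMetric

-- Norms on iterated spaces of continuous linear maps are found only with deeper pending problems.
set_option maxSynthPendingDepth 3

/-! ### The Levi-Civita connection in a chart -/

section ChartMetric

open Filter Topology

variable {E : Type*} [NormedAddCommGroup E] [NormedSpace ℝ E]

/-- `h` is the expression of a smooth Riemannian metric in a chart with image the open set `U`. -/
structure IsChartMetric (h : E → E →L[ℝ] E →L[ℝ] ℝ) (U : Set E) : Prop where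
  isOpen : IsOpen U
  contDiffOn : ContDiffOn ℝ ∞ h U
  symm : ∀ y ∈ U, ∀ v w, h y v w = h y w v
  pos : ∀ y ∈ U, ∀ v, v ≠ 0 → 0 < h y v v

theorem isSymmSndFDerivAt_of_contDiffAt_infty {F G : Type*} [NormedAddCommGroup F]
    [NormedSpace ℝ F] [NormedAddCommGroup G] [NormedSpace ℝ G] {f : F → G} {x : F}
    (hf : ContDiffAt ℝ ∞ f x) : IsSymmSndFDerivAt ℝ f x :=
  hf.isSymmSndFDerivAt (by simpa using (mod_cast le_top : ((2 : ℕ∞) : ℕ∞ω) ≤ ∞))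

theorem fderiv_symm_of_eventually {h : E → E →L[ℝ] E →L[ℝ] ℝ} {y : E}
    (hd : DifferentiableAt ℝ h y) (hs : ∀ᶠ y' in 𝓝 y, ∀ v w, h y' v w = h y' w v) (z v w : E) :
    fderiv ℝ h y z v w = fderiv ℝ h y z w v := by
  have key : ∀ v w : E, HasFDerivAt (fun y' => h y' v w)
      ((ContinuousLinearMap.apply ℝ ℝ w ∘L ContinuousLinearMap.apply ℝ (E →L[ℝ] ℝ) v) ∘L
        fderiv ℝ h y) y := fun v w =>
    ((ContinuousLinearMap.apply ℝ ℝ w ∘L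
      ContinuousLinearMap.apply ℝ (E →L[ℝ] ℝ) v).hasFDerivAt).comp y hd.hasFDerivAt
  have h2 := (key v w).unique ((key w v).congr_of_eventuallyEq (hs.mono fun y' h' => h' v w))
  simpa using congrArg (fun L => L z) h2

/-- The Christoffel symbols are determined by symmetry and compatibility with the metric. -/
theorem christoffel_eq_of_symm_of_compatible {h : E → E →L[ℝ] E →L[ℝ] ℝ} {y : E}
    (hy : (h y).IsInvertible) (hs : ∀ v w, h y v w = h y w v) (B : E → E → E)
    (hB : ∀ v w, B v w = B w v)
    (hc : ∀ z v w, fderiv ℝ h y z v w = h y (B z v) w + h y v (B z w)) (v w : E) :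
    christoffel h y v w = B v w := by
  have hinj : Function.Injective (h y) := by
    obtain ⟨e, he⟩ := hy
    rw [← he]; exact e.injective
  apply hinj
  ext z
  rw [christoffel_spec hy, christoffelFirst_apply, hc, hc, hc, hB w v, hB z v, hB z w,
    hs v (B w z), hs w (B v z), hs (B v z) w]
  ring

theorem christoffel_congr {h h' : E → E →L[ℝ] E →L[ℝ] ℝ} {y : E} (hh : h =ᶠ[𝓝 y] h') (v : E) :
    christoffel h y v = christoffel h' y v := by
  simp only [christoffel, christoffelFirst, hh.fderiv_eq, hh.eq_of_nhds]

theorem curvature_congr {h h' : E → E →L[ℝ] E →L[ℝ] ℝ} {y : E} (hh : h =ᶠ[𝓝 y] h') (v w z : E) :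
    curvature h y v w z = curvature h' y v w z := by
  have key : ∀ w z : E, (fun y' => christoffel h y' w z) =ᶠ[𝓝 y] fun y' => christoffel h' y' w z :=
    fun w z => hh.eventually_nhds.mono fun y' h2 => by simp only [christoffel_congr h2]
  simp only [curvature, (key _ _).fderiv_eq, christoffel_congr hh]

theorem curvature_antisymm (h : E → E →L[ℝ] E →L[ℝ] ℝ) (y v w z : E) :
    curvature h y v w z = - curvature h y w v z := by
  simp only [curvature]; abel

variable {h : E → E →L[ℝ] E →L[ℝ] ℝ} {U : Set E} {y : E}

namespace IsChartMetric

variable (H : IsChartMetric h U) (hy : y ∈ U)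
include H hy

theorem mem_nhds : U ∈ 𝓝 y := H.isOpen.mem_nhds hy

theorem contDiffAt : ContDiffAt ℝ ∞ h y := H.contDiffOn.contDiffAt (H.mem_nhds hy)

theorem differentiableAt : DifferentiableAt ℝ h y :=
  (H.contDiffAt hy).differentiableAt (by simp)

theorem isInvertible [FiniteDimensional ℝ E] : (h y).IsInvertible := by
  have hinj : Function.Injective (h y : E →ₗ[ℝ] E →L[ℝ] ℝ) := by
    rw [← LinearMap.ker_eq_bot, LinearMap.ker_eq_bot']
    intro v hv
    by_contra h0
    have := H.pos y hy v h0
    have h2 : h y v = 0 := hv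
    simp [h2] at this
  have hfr : Module.finrank ℝ E = Module.finrank ℝ (E →L[ℝ] ℝ) := by
    rw [← (LinearMap.toContinuousLinearMap (E := E) (F' := ℝ) (𝕜 := ℝ)).finrank_eq]
    simp
  exact ⟨(LinearEquiv.ofInjectiveOfFinrankEq _ hinj hfr).toContinuousLinearEquiv, by ext; rfl⟩

theorem fderiv_symm (z v w : E) : fderiv ℝ h y z v w = fderiv ℝ h y z w v :=
  fderiv_symm_of_eventually (H.differentiableAt hy)
    ((H.isOpen.eventually_mem hy).mono H.symm) z v w

theorem ext_inner {v w : E} (hvw : ∀ z, h y v z = h y w z) : v = w := by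
  by_contra h0
  have := H.pos y hy (v - w) (sub_ne_zero.2 h0)
  simp [hvw] at this

variable [FiniteDimensional ℝ E]

theorem christoffel_symm (v w : E) : christoffel h y v w = christoffel h y w v := by
  refine H.ext_inner hy fun z => ?_
  rw [christoffel_spec (H.isInvertible hy), christoffel_spec (H.isInvertible hy),
    christoffelFirst_apply, christoffelFirst_apply, H.fderiv_symm hy z v w]
  ring

/-- The Levi-Civita connection is compatible with the metric. -/
theorem fderiv_eq (z v w : E) :
    fderiv ℝ h y z v w = h y (christoffel h y z v) w + h y v (christoffel h y z w) := by
  rw [H.symm y hy v, christoffel_spec (H.isInvertible hy), christoffel_spec (H.isInvertible hy),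
    christoffelFirst_apply, christoffelFirst_apply, H.fderiv_symm hy z w v,
    H.fderiv_symm hy v z w, H.fderiv_symm hy w z v]
  ring

omit hy in
theorem contDiffAt_christoffel {X : Type*} [NormedAddCommGroup X] [NormedSpace ℝ X]
    {f v : X → E} {x : X} (hx : f x ∈ U) (hf : ContDiffAt ℝ ∞ f x) (hv : ContDiffAt ℝ ∞ v x) :
    ContDiffAt ℝ ∞ (fun x' => christoffel h (f x') (v x')) x := by
  have h1 : ContDiffAt ℝ ∞ (fun x' => h (f x')) x := (H.contDiffAt hx).comp x hf
  have h2 : ContDiffAt ℝ ∞ (fun x' => fderiv ℝ h (f x')) x :=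
    ((H.contDiffAt hx).fderiv_right (m := ∞) (by simp)).comp x hf
  have h3 : ContDiffAt ℝ ∞ (fun x' => ContinuousLinearMap.inverse (h (f x'))) x := by
    obtain ⟨e, he⟩ := H.isInvertible hx
    have := contDiffAt_map_inverse (n := ∞) e
    rw [he] at this
    exact this.comp x h1
  have h4 : ContDiffAt ℝ ∞ (fun x' => (fderiv ℝ h (f x')).flip) x :=
    (ContinuousLinearMap.flipₗᵢ ℝ E E (E →L[ℝ] ℝ)).contDiff.contDiffAt.comp x h2
  have h5 : ContDiffAt ℝ ∞ (fun x' => ((fderiv ℝ h (f x')).flip (v x')).flip) x :=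
    (ContinuousLinearMap.flipₗᵢ ℝ E E ℝ).contDiff.contDiffAt.comp x (h4.clm_apply hv)
  exact h3.clm_comp (ContDiffAt.const_smul (1 / 2 : ℝ)
    (((h2.clm_apply hv).add (h4.clm_apply hv)).sub h5))

theorem differentiableAt_christoffel (v : E) :
    DifferentiableAt ℝ (fun y' => christoffel h y' v) y :=
  (H.contDiffAt_christoffel hy contDiffAt_id contDiffAt_const).differentiableAt (by simp)

theorem fderiv_christoffel_apply (v w z : E) :
    fderiv ℝ (fun y' => christoffel h y' v w) y z =
      fderiv ℝ (fun y' => christoffel h y' v) y z w := by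
  rw [fderiv_clm_apply (H.differentiableAt_christoffel hy v) (differentiableAt_const w)]
  simp

end IsChartMetric

/-- The transformation law of the Christoffel symbols under a change of charts `φ`: the pullback of
the connection of `h'` is symmetric and compatible with `h`. -/
theorem christoffel_changeOfCharts [FiniteDimensional ℝ E] {h' : E → E →L[ℝ] E →L[ℝ] ℝ} {U' : Set E}
    (H : IsChartMetric h U) (H' : IsChartMetric h' U') (hy : y ∈ U) {φ : E → E} (hφy : φ y ∈ U')
    (hφ : ContDiffAt ℝ ∞ φ y)
    (hh : ∀ᶠ y' in 𝓝 y, ∀ v w, h y' v w = h' (φ y') (fderiv ℝ φ y' v) (fderiv ℝ φ y' w))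
    (v w : E) :
    fderiv ℝ φ y (christoffel h y v w) =
      fderiv ℝ (fderiv ℝ φ) y v w + christoffel h' (φ y) (fderiv ℝ φ y v) (fderiv ℝ φ y w) := by
  have hinj : Function.Injective (fderiv ℝ φ y : E →ₗ[ℝ] E) := by
    rw [← LinearMap.ker_eq_bot, LinearMap.ker_eq_bot']
    intro v hv
    by_contra h0
    have h1 := H.pos y hy v h0
    have h2 : fderiv ℝ φ y v = 0 := hv
    rw [hh.self_of_nhds, h2] at h1
    simp at h1
  obtain ⟨e, he⟩ : ∃ e : E ≃ₗ[ℝ] E, ∀ x, e x = fderiv ℝ φ y x :=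
    ⟨LinearEquiv.ofInjectiveEndo _ hinj, fun x => rfl⟩
  have hes : ∀ x, fderiv ℝ φ y (e.symm x) = x := fun x => by rw [← he, e.apply_symm_apply]
  have h2 : ContDiffAt ℝ ∞ (fderiv ℝ φ) y := hφ.fderiv_right (m := ∞) (by simp)
  have hd2 : HasFDerivAt (fderiv ℝ φ) (fderiv ℝ (fderiv ℝ φ) y) y :=
    (h2.differentiableAt (by simp)).hasFDerivAt
  have hd1 : HasFDerivAt φ (fderiv ℝ φ y) y := (hφ.differentiableAt (by simp)).hasFDerivAt
  have hsymm : IsSymmSndFDerivAt ℝ φ y := isSymmSndFDerivAt_of_contDiffAt_infty hφ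
  have hder : ∀ z v w, fderiv ℝ h y z v w =
      fderiv ℝ h' (φ y) (fderiv ℝ φ y z) (fderiv ℝ φ y v) (fderiv ℝ φ y w)
      + h' (φ y) (fderiv ℝ (fderiv ℝ φ) y z v) (fderiv ℝ φ y w)
      + h' (φ y) (fderiv ℝ φ y v) (fderiv ℝ (fderiv ℝ φ) y z w) := by
    intro z v w
    have key : HasFDerivAt (fun y' => h y' v w)
      ((ContinuousLinearMap.apply ℝ ℝ w ∘L ContinuousLinearMap.apply ℝ (E →L[ℝ] ℝ) v) ∘L
        fderiv ℝ h y) y :=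
      ((ContinuousLinearMap.apply ℝ ℝ w ∘L
        ContinuousLinearMap.apply ℝ (E →L[ℝ] ℝ) v).hasFDerivAt).comp y
          (H.differentiableAt hy).hasFDerivAt
    have k1 : HasFDerivAt (fun y' => h' (φ y')) (fderiv ℝ h' (φ y) ∘L fderiv ℝ φ y) y :=
      (H'.differentiableAt hφy).hasFDerivAt.comp y hd1
    have k2 := (k1.clm_apply (hd2.clm_apply (hasFDerivAt_const v y))).clm_apply
      (hd2.clm_apply (hasFDerivAt_const w y))
    have k3 := key.unique (k2.congr_of_eventuallyEq (hh.mono fun y' h'' => h'' v w))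
    have k4 := congrArg (fun L => L z) k3
    simp at k4
    rw [k4]; ring
  have := christoffel_eq_of_symm_of_compatible (H.isInvertible hy) (H.symm y hy)
    (fun v w => e.symm (fderiv ℝ (fderiv ℝ φ) y v w
      + christoffel h' (φ y) (fderiv ℝ φ y v) (fderiv ℝ φ y w)))
    (fun v w => by rw [hsymm.eq, H'.christoffel_symm hφy])
    (fun z v w => by
      rw [hder, hh.self_of_nhds, hh.self_of_nhds, hes, hes, H'.fderiv_eq hφy]
      simp only [map_add, add_apply]
      ring) v w
  rw [this, hes]

end ChartMetric

/-! ### The Levi-Civita connection of the weighted Sasaki metric -/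

section SasakiForm

open Filter Topology

variable {E : Type*} [NormedAddCommGroup E] [NormedSpace ℝ E]

/-- The vertical component `α + Γ_y(η, a)` of the tangent vector `(a, α)` of `TM` at the point with
induced coordinates `(y, η)`. -/
noncomputable def verticalPart (h : E → E →L[ℝ] E →L[ℝ] ℝ) (c : E × E) : E × E →L[ℝ] E :=
  ContinuousLinearMap.snd ℝ E E + christoffel h c.1 c.2 ∘L ContinuousLinearMap.fst ℝ E E

theorem verticalPart_apply (h : E → E →L[ℝ] E →L[ℝ] ℝ) (c A : E × E) :
    verticalPart h c A = A.2 + christoffel h c.1 c.2 A.1 := rfl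

/-- The expression of the weighted Sasaki metric in the coordinates of `TM` induced by a chart of
`M` in which the metric is `h`. -/
noncomputable def sasakiForm (h : E → E →L[ℝ] E →L[ℝ] ℝ) (f₁ f₂ : ℝ) (c : E × E) :
    E × E →L[ℝ] E × E →L[ℝ] ℝ :=
  f₁ • (ContinuousLinearMap.precomp ℝ (ContinuousLinearMap.fst ℝ E E) ∘L h c.1 ∘L
      ContinuousLinearMap.fst ℝ E E)
    + f₂ • (ContinuousLinearMap.precomp ℝ (verticalPart h c) ∘L h c.1 ∘L verticalPart h c)

theorem sasakiForm_apply (h : E → E →L[ℝ] E →L[ℝ] ℝ) (f₁ f₂ : ℝ) (c A B : E × E) :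
    sasakiForm h f₁ f₂ c A B = f₁ * h c.1 A.1 B.1
      + f₂ * h c.1 (verticalPart h c A) (verticalPart h c B) := rfl

/-- The derivative at `c`, in the direction `A`, of the vertical component of the constant vector
field `B`. -/
noncomputable def verticalPartDeriv (h : E → E →L[ℝ] E →L[ℝ] ℝ) (c A B : E × E) : E :=
  fderiv ℝ (fun y => christoffel h y B.1) c.1 A.1 c.2 + christoffel h c.1 B.1 A.2

namespace IsChartMetric

variable {h : E → E →L[ℝ] E →L[ℝ] ℝ} {U : Set E} [FiniteDimensional ℝ E]
  (H : IsChartMetric h U) {f₁ f₂ : ℝ} {c : E × E} (hc : c.1 ∈ U)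
include H

theorem contDiffAt_verticalPart (hc : c.1 ∈ U) : ContDiffAt ℝ ∞ (verticalPart h) c :=
  contDiffAt_const.add
    ((H.contDiffAt_christoffel hc contDiffAt_fst contDiffAt_snd).clm_comp contDiffAt_const)

theorem isChartMetric_sasakiForm (hf₁ : 0 < f₁) (hf₂ : 0 < f₂) :
    IsChartMetric (sasakiForm h f₁ f₂) (U ×ˢ Set.univ) where
  isOpen := H.isOpen.prod isOpen_univ
  contDiffOn := by
    refine contDiffOn_clm_apply.2 fun A => contDiffOn_clm_apply.2 fun B => fun c hc => ?_
    have h1 : ContDiffAt ℝ ∞ (fun c : E × E => h c.1) c :=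
      (H.contDiffAt hc.1).comp c contDiffAt_fst
    have h2 := H.contDiffAt_verticalPart hc.1
    refine ContDiffAt.contDiffWithinAt ?_
    simp only [sasakiForm_apply]
    exact (contDiffAt_const.mul ((h1.clm_apply contDiffAt_const).clm_apply contDiffAt_const)).add
      (contDiffAt_const.mul ((h1.clm_apply (h2.clm_apply contDiffAt_const)).clm_apply
        (h2.clm_apply contDiffAt_const)))
  symm c hc A B := by
    rw [sasakiForm_apply, sasakiForm_apply, H.symm _ hc.1, H.symm _ hc.1 (verticalPart h c A)]
  pos c hc A hA := by
    have nonneg : ∀ v, 0 ≤ h c.1 v v := fun v => by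
      by_cases hv : v = 0
      · simp [hv]
      · exact (H.pos _ hc.1 v hv).le
    rw [sasakiForm_apply]
    by_cases ha : A.1 = 0
    · have hb : A.2 ≠ 0 := fun hb => hA (Prod.ext ha hb)
      have := H.pos _ hc.1 _ hb
      simp only [verticalPart_apply, ha, map_zero, add_zero, mul_zero, zero_add]
      positivity
    · have h1 := H.pos _ hc.1 _ ha
      have h2 := nonneg (verticalPart h c A)
      positivity

include hc

theorem hasFDerivAt_verticalPart (B : E × E) :
    ∃ L : E × E →L[ℝ] E, HasFDerivAt (fun c' => verticalPart h c' B) L c ∧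
      ∀ A, L A = verticalPartDeriv h c A B := by
  have h1 : HasFDerivAt (fun c' : E × E => christoffel h c'.1 B.1)
      (fderiv ℝ (fun y => christoffel h y B.1) c.1 ∘L ContinuousLinearMap.fst ℝ E E) c :=
    (H.differentiableAt_christoffel hc B.1).hasFDerivAt.comp c hasFDerivAt_fst
  have h2 := (h1.clm_apply (hasFDerivAt_snd (𝕜 := ℝ) (p := c))).const_add B.2
  -- By symmetry of `Γ`, the fibre coordinate may be the argument of a linear map.
  refine ⟨_, h2.congr_of_eventuallyEq ?_, fun A => ?_⟩
  · filter_upwards [(H.isOpen.preimage continuous_fst).mem_nhds hc] with c' hc'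
    rw [verticalPart_apply, H.christoffel_symm hc']
  · simp [verticalPartDeriv, add_comm]

/-- The derivative of the vertical component fails to be torsion free by the curvature of `M`. -/
theorem verticalPartDeriv_comm (A B : E × E) :
    verticalPartDeriv h c B A = verticalPartDeriv h c A B
      + christoffel h c.1 A.1 (verticalPart h c B) - christoffel h c.1 B.1 (verticalPart h c A)
      - curvature h c.1 A.1 B.1 c.2 := by
  simp only [verticalPartDeriv, verticalPart_apply, curvature, map_add,
    H.fderiv_christoffel_apply hc, H.christoffel_symm hc c.2]
  abel

theorem fderiv_sasakiForm (hf₁ : 0 < f₁) (hf₂ : 0 < f₂) (C A B : E × E) :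
    fderiv ℝ (sasakiForm h f₁ f₂) c C A B =
      f₁ * (h c.1 (christoffel h c.1 C.1 A.1) B.1 + h c.1 A.1 (christoffel h c.1 C.1 B.1))
      + f₂ * (h c.1 (verticalPartDeriv h c C A + christoffel h c.1 C.1 (verticalPart h c A))
            (verticalPart h c B)
          + h c.1 (verticalPart h c A)
            (verticalPartDeriv h c C B + christoffel h c.1 C.1 (verticalPart h c B))) := by
  have HG := H.isChartMetric_sasakiForm hf₁ hf₂
  have hd : HasFDerivAt (sasakiForm h f₁ f₂) (fderiv ℝ (sasakiForm h f₁ f₂) c) c :=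
    (HG.differentiableAt ⟨hc, Set.mem_univ _⟩).hasFDerivAt
  have k1 := (hd.clm_apply (hasFDerivAt_const A c)).clm_apply (hasFDerivAt_const B c)
  have h1 : HasFDerivAt (fun c' : E × E => h c'.1)
      (fderiv ℝ h c.1 ∘L ContinuousLinearMap.fst ℝ E E) c :=
    (H.differentiableAt hc).hasFDerivAt.comp c hasFDerivAt_fst
  obtain ⟨LA, hLA, hLA'⟩ := H.hasFDerivAt_verticalPart hc A
  obtain ⟨LB, hLB, hLB'⟩ := H.hasFDerivAt_verticalPart hc B
  have k2 := (((h1.clm_apply (hasFDerivAt_const A.1 c)).clm_apply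
    (hasFDerivAt_const B.1 c)).const_mul f₁).add
    (((h1.clm_apply hLA).clm_apply hLB).const_mul f₂)
  have k3 := congrArg (fun L => L C) (k1.unique k2)
  simp [hLA', hLB'] at k3
  rw [k3, H.fderiv_eq hc, H.fderiv_eq hc]
  simp only [map_add, add_apply]
  ring

/-- The Koszul formula for the weighted Sasaki metric: its connection is the pullback of `∇ ⊕ ∇`, up
to terms that are linear in the curvature of `M`. -/
theorem sasakiForm_christoffel (hf₁ : 0 < f₁) (hf₂ : 0 < f₂) (A B C : E × E) :
    sasakiForm h f₁ f₂ c (christoffel (sasakiForm h f₁ f₂) c A B) C =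
      f₁ * h c.1 (christoffel h c.1 A.1 B.1) C.1
      + f₂ * h c.1 (verticalPartDeriv h c A B + christoffel h c.1 A.1 (verticalPart h c B))
          (verticalPart h c C)
      + f₂ / 2 * (h c.1 (verticalPart h c B) (curvature h c.1 A.1 C.1 c.2)
          + h c.1 (verticalPart h c A) (curvature h c.1 B.1 C.1 c.2)
          - h c.1 (verticalPart h c C) (curvature h c.1 A.1 B.1 c.2)) := by
  have HG := H.isChartMetric_sasakiForm hf₁ hf₂
  rw [christoffel_spec (HG.isInvertible (y := c) ⟨hc, Set.mem_univ _⟩), christoffelFirst_apply,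
    H.fderiv_sasakiForm hc hf₁ hf₂, H.fderiv_sasakiForm hc hf₁ hf₂,
    H.fderiv_sasakiForm hc hf₁ hf₂, H.verticalPartDeriv_comm hc A B,
    H.verticalPartDeriv_comm hc A C, H.verticalPartDeriv_comm hc B C,
    H.christoffel_symm hc B.1 A.1, H.christoffel_symm hc C.1 A.1, H.christoffel_symm hc C.1 B.1]
  simp only [map_add, map_sub, add_apply, sub_apply]
  have hs := H.symm c.1 hc
  rw [hs (christoffel h c.1 A.1 C.1) B.1, hs A.1, hs (curvature h c.1 A.1 B.1 c.2),
    hs (curvature h c.1 A.1 C.1 c.2), hs (verticalPart h c A) (verticalPartDeriv h c B C),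
    hs (verticalPart h c B) (verticalPartDeriv h c A C),
    hs (christoffel h c.1 A.1 (verticalPart h c C)) (verticalPart h c B)]
  ring

end IsChartMetric
end SasakiForm

/-! ### Traces of skew-symmetric endomorphisms -/

section SkewTrace

variable {V : Type*} [AddCommGroup V] [Module ℝ V] [FiniteDimensional ℝ V]

/-- The trace of an endomorphism, computed in a basis orthogonal for a positive definite form. -/
theorem exists_basis_trace_eq_sum (B : LinearMap.BilinForm ℝ V) (hs : ∀ v w, B v w = B w v)
    (hp : ∀ v, v ≠ 0 → 0 < B v v) :
    ∃ b : Module.Basis (Fin (Module.finrank ℝ V)) ℝ V, ∀ T : V →ₗ[ℝ] V,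
      LinearMap.trace ℝ V T = ∑ i, B (T (b i)) (b i) / B (b i) (b i) := by
  obtain ⟨b, hb⟩ := LinearMap.BilinForm.exists_orthogonal_basis (B := B)
    (LinearMap.isSymm_def.2 fun v w => hs v w)
  refine ⟨b, fun T => ?_⟩
  rw [LinearMap.trace_eq_matrix_trace ℝ b]
  refine Finset.sum_congr rfl fun i _ => ?_
  rw [Matrix.diag_apply, LinearMap.toMatrix_apply]
  have h1 : B (T (b i)) (b i) = b.repr (T (b i)) i * B (b i) (b i) := by
    conv_lhs => rw [← b.sum_repr (T (b i))]
    rw [map_sum, LinearMap.sum_apply, Finset.sum_eq_single i]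
    · simp
    · intro j _ hj
      have h2 : B (b j) (b i) = 0 := hb hj
      simp [h2]
    · simp
  rw [h1, mul_div_cancel_right₀ _ (hp _ (b.ne_zero i)).ne']

theorem trace_eq_zero_of_skew (B : LinearMap.BilinForm ℝ V) (hs : ∀ v w, B v w = B w v)
    (hp : ∀ v, v ≠ 0 → 0 < B v v) (T : V →ₗ[ℝ] V) (hT : ∀ v w, B (T v) w = - B (T w) v) :
    LinearMap.trace ℝ V T = 0 := by
  obtain ⟨b, hb⟩ := exists_basis_trace_eq_sum B hs hp
  rw [hb]
  refine Finset.sum_eq_zero fun i _ => ?_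
  have := hT (b i) (b i)
  rw [show B (T (b i)) (b i) = 0 by linarith, zero_div]

/-- For skew-symmetric `T`, the number `- tr T²` is the squared norm of `T`. -/
theorem eq_zero_of_skew_of_trace_sq (B : LinearMap.BilinForm ℝ V) (hs : ∀ v w, B v w = B w v)
    (hp : ∀ v, v ≠ 0 → 0 < B v v) (T : V →ₗ[ℝ] V) (hT : ∀ v w, B (T v) w = - B (T w) v)
    (h0 : LinearMap.trace ℝ V (T ∘ₗ T) = 0) : T = 0 := by
  obtain ⟨b, hb⟩ := exists_basis_trace_eq_sum B hs hp
  have hnn : ∀ v, 0 ≤ B v v := fun v => by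
    by_cases hv : v = 0
    · simp [hv]
    · exact (hp v hv).le
  rw [hb] at h0
  have h1 : ∑ i, B (T (b i)) (T (b i)) / B (b i) (b i) = 0 := by
    rw [← neg_eq_zero, ← h0, ← Finset.sum_neg_distrib]
    refine Finset.sum_congr rfl fun i _ => ?_
    rw [LinearMap.comp_apply, hT (T (b i)), neg_div]
  have h2 := (Finset.sum_eq_zero_iff_of_nonneg fun i _ =>
    div_nonneg (hnn (T (b i))) (hnn (b i))).1 h1
  refine b.ext fun i => ?_
  by_contra h3
  exact (div_pos (hp _ h3) (hp _ (b.ne_zero i))).ne' (h2 i (Finset.mem_univ i))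

end SkewTrace

/-! ### The curvature of the weighted Sasaki metric -/

section SasakiCurvature

open Filter Topology

variable {E : Type*} [NormedAddCommGroup E] [NormedSpace ℝ E]

theorem christoffel_zero (h : E → E →L[ℝ] E →L[ℝ] ℝ) (y : E) : christoffel h y 0 = 0 := by
  ext v
  simp [christoffel, christoffelFirst]

theorem curvature_zero_left (h : E → E →L[ℝ] E →L[ℝ] ℝ) (y w z : E) :
    curvature h y 0 w z = 0 := by
  simp [curvature, christoffel_zero]

namespace IsChartMetric

variable {h : E → E →L[ℝ] E →L[ℝ] ℝ} {U : Set E} [FiniteDimensional ℝ E]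
  (H : IsChartMetric h U) {f₁ f₂ : ℝ} {c : E × E} (hc : c.1 ∈ U)
include H hc

theorem fderiv_verticalPart (A B : E × E) :
    fderiv ℝ (fun c' => verticalPart h c' B) c A = verticalPartDeriv h c A B := by
  obtain ⟨L, hL, hL'⟩ := H.hasFDerivAt_verticalPart hc B
  rw [hL.fderiv, hL']

/-- Over a flat metric, the Levi-Civita connection of the weighted Sasaki metric is the pullback of
`∇ ⊕ ∇`. -/
theorem sasakiForm_christoffel_of_flat (hf₁ : 0 < f₁) (hf₂ : 0 < f₂)
    (hR : ∀ v w z, curvature h c.1 v w z = 0) (A B : E × E) :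
    (christoffel (sasakiForm h f₁ f₂) c A B).1 = christoffel h c.1 A.1 B.1 ∧
    verticalPart h c (christoffel (sasakiForm h f₁ f₂) c A B) =
      verticalPartDeriv h c A B + christoffel h c.1 A.1 (verticalPart h c B) := by
  have HG := H.isChartMetric_sasakiForm hf₁ hf₂
  set X : E × E := (christoffel h c.1 A.1 B.1,
    verticalPartDeriv h c A B + christoffel h c.1 A.1 (verticalPart h c B)
      - christoffel h c.1 c.2 (christoffel h c.1 A.1 B.1)) with hX
  have hθ : verticalPart h c X =
      verticalPartDeriv h c A B + christoffel h c.1 A.1 (verticalPart h c B) := by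
    rw [verticalPart_apply, hX]; simp
  have : christoffel (sasakiForm h f₁ f₂) c A B = X := by
    refine HG.ext_inner (y := c) ⟨hc, Set.mem_univ _⟩ fun C => ?_
    rw [H.sasakiForm_christoffel hc hf₁ hf₂, sasakiForm_apply, hθ, hX]
    simp [hR]
  rw [this]
  exact ⟨rfl, hθ⟩

omit hc in
/-- The weighted Sasaki metric of a flat metric is flat. -/
theorem curvature_sasakiForm_eq_zero (hf₁ : 0 < f₁) (hf₂ : 0 < f₂)
    (hR : ∀ y ∈ U, ∀ v w z, curvature h y v w z = 0) (hc : c.1 ∈ U) (A B Z : E × E) :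
    curvature (sasakiForm h f₁ f₂) c A B Z = 0 := by
  have HG := H.isChartMetric_sasakiForm hf₁ hf₂
  have hcU : c ∈ U ×ˢ (Set.univ : Set E) := ⟨hc, Set.mem_univ _⟩
  have hnear : ∀ᶠ c' in 𝓝 c, c'.1 ∈ U := (H.isOpen.preimage continuous_fst).mem_nhds hc
  set Γ := christoffel (sasakiForm h f₁ f₂) with hΓ
  have hform : ∀ c' : E × E, c'.1 ∈ U → ∀ A B : E × E,
      (Γ c' A B).1 = christoffel h c'.1 A.1 B.1 ∧
      verticalPart h c' (Γ c' A B) =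
        verticalPartDeriv h c' A B + christoffel h c'.1 A.1 (verticalPart h c' B) :=
    fun c' hc' => H.sasakiForm_christoffel_of_flat hc' hf₁ hf₂ (hR _ hc')
  have hΓd : ∀ B, HasFDerivAt (fun c' => Γ c' B Z) (fderiv ℝ (fun c' => Γ c' B Z) c) c :=
    fun B => ((HG.differentiableAt_christoffel hcU B).clm_apply
      (differentiableAt_const Z)).hasFDerivAt
  have hθd : HasFDerivAt (verticalPart h) (fderiv ℝ (verticalPart h) c) c :=
    ((H.contDiffAt_verticalPart hc).differentiableAt (by simp)).hasFDerivAt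
  -- The first component of the connection only depends on the base point.
  have hfst : ∀ A B : E × E, (fderiv ℝ (fun c' => Γ c' B Z) c A).1 =
      fderiv ℝ (fun y => christoffel h y B.1) c.1 A.1 Z.1 := by
    intro A B
    have h1 := (hΓd B).fst
    have h2 : HasFDerivAt (fun c' : E × E => christoffel h c'.1 B.1 Z.1) _ c :=
      ((H.differentiableAt_christoffel hc B.1).hasFDerivAt.comp c hasFDerivAt_fst).clm_apply
        (hasFDerivAt_const Z.1 c)
    have h3 := h1.unique (h2.congr_of_eventuallyEq (hnear.mono fun c' hc' => (hform c' hc' B Z).1))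
    simpa using congrArg (fun L => L A) h3
  -- The derivative of the formula for the vertical component of the connection.
  have hsnd : ∀ A B : E × E, verticalPart h c (fderiv ℝ (fun c' => Γ c' B Z) c A) =
      fderiv ℝ (fderiv ℝ (fun c' => verticalPart h c' Z)) c A B
        + fderiv ℝ (fun y => christoffel h y B.1) c.1 A.1 (verticalPart h c Z)
        + christoffel h c.1 B.1 (verticalPartDeriv h c A Z)
        - verticalPartDeriv h c A (Γ c B Z) := by
    intro A B
    have h1 := hθd.clm_apply (hΓd B)
    have hψ : ContDiffAt ℝ ∞ (fun c' => verticalPart h c' Z) c :=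
      (H.contDiffAt_verticalPart hc).clm_apply contDiffAt_const
    have h2 : HasFDerivAt (fun c' => fderiv ℝ (fun c' => verticalPart h c' Z) c' B) _ c :=
      ((hψ.fderiv_right (m := ∞) (by simp)).differentiableAt (by simp)).hasFDerivAt.clm_apply
        (hasFDerivAt_const B c)
    have h3 : HasFDerivAt (fun c' : E × E => christoffel h c'.1 B.1) _ c :=
      (H.differentiableAt_christoffel hc B.1).hasFDerivAt.comp c hasFDerivAt_fst
    have h4 := h2.add (h3.clm_apply (hψ.differentiableAt (by simp)).hasFDerivAt)
    have h5 := h1.unique (h4.congr_of_eventuallyEq (hnear.mono fun c' hc' => by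
      simp only [Pi.add_apply]
      rw [(hform c' hc' B Z).2, H.fderiv_verticalPart hc']))
    have h6 := congrArg (fun L => L A) h5
    have h7 : fderiv ℝ (verticalPart h) c A (Γ c B Z) = verticalPartDeriv h c A (Γ c B Z) := by
      rw [← H.fderiv_verticalPart hc, fderiv_clm_apply hθd.differentiableAt
        (differentiableAt_const _)]
      simp
    simp [H.fderiv_verticalPart hc, h7] at h6
    rw [eq_sub_iff_add_eq, h6]
    abel
  have hsymm : IsSymmSndFDerivAt ℝ (fun c' => verticalPart h c' Z) c :=
    isSymmSndFDerivAt_of_contDiffAt_infty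
      ((H.contDiffAt_verticalPart hc).clm_apply contDiffAt_const)
  have hRz : ∀ z, curvature h c.1 A.1 B.1 z = 0 := fun z => hR _ hc _ _ _
  have k1 : (curvature (sasakiForm h f₁ f₂) c A B Z).1 = 0 := by
    rw [← hRz Z.1]
    simp only [curvature, ← hΓ, Prod.fst_add, Prod.fst_sub, hfst, (hform c hc _ _).1,
      H.fderiv_christoffel_apply hc]
  have k2 : verticalPart h c (curvature (sasakiForm h f₁ f₂) c A B Z) = 0 := by
    rw [← hRz (verticalPart h c Z)]
    simp only [curvature, ← hΓ, map_add, map_sub, hsnd, (hform c hc _ _).2,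
      H.fderiv_christoffel_apply hc, hsymm.eq A B]
    abel
  refine Prod.ext k1 ?_
  simpa [verticalPart_apply, k1] using k2

/-- The Levi-Civita connection of the weighted Sasaki metric in a vertical direction. -/
theorem sasakiForm_christoffel_vertical (hf₁ : 0 < f₁) (hf₂ : 0 < f₂) (ξ : E) (B C : E × E) :
    sasakiForm h f₁ f₂ c (christoffel (sasakiForm h f₁ f₂) c (0, ξ) B) C =
      f₂ * h c.1 (christoffel h c.1 B.1 ξ) (verticalPart h c C)
      + f₂ / 2 * h c.1 ξ (curvature h c.1 B.1 C.1 c.2) := by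
  rw [H.sasakiForm_christoffel hc hf₁ hf₂]
  simp [christoffel_zero, curvature_zero_left, verticalPartDeriv, verticalPart_apply]

/-- The horizontal part of the connection in a vertical direction is read off by pairing it with
horizontal vectors. -/
theorem sasakiForm_christoffel_vertical_fst (hf₁ : 0 < f₁) (hf₂ : 0 < f₂) (ξ : E) (B : E × E)
    (v : E) :
    f₁ * h c.1 (christoffel (sasakiForm h f₁ f₂) c (0, ξ) B).1 v =
      f₂ / 2 * h c.1 ξ (curvature h c.1 B.1 v c.2) := by
  have := H.sasakiForm_christoffel_vertical hc hf₁ hf₂ ξ B (v, - christoffel h c.1 c.2 v)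
  rw [sasakiForm_apply] at this
  simpa [verticalPart_apply] using this

theorem sasakiForm_christoffel_vertical_vertical (hf₁ : 0 < f₁) (hf₂ : 0 < f₂) (ξ ζ : E) :
    christoffel (sasakiForm h f₁ f₂) c (0, ξ) (0, ζ) = 0 := by
  have HG := H.isChartMetric_sasakiForm hf₁ hf₂
  refine HG.ext_inner (y := c) ⟨hc, Set.mem_univ _⟩ fun C => ?_
  rw [H.sasakiForm_christoffel_vertical hc hf₁ hf₂]
  simp [christoffel_zero, curvature_zero_left]

omit H hc in
/-- The endomorphism `v ↦ dπ (∇_v ξ)` of `T_y M`, where `ξ` is extended as a constant vertical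
vector field. Any lift of `v` to `TM` may be used, since `∇_ζ ξ = 0` for vertical `ζ`; here it is
`(v, 0)`. -/
noncomputable def horizontalShape (h : E → E →L[ℝ] E →L[ℝ] ℝ) (f₁ f₂ : ℝ) (c : E × E) (ξ : E) :
    E →ₗ[ℝ] E :=
  LinearMap.fst ℝ E E ∘ₗ (christoffel (sasakiForm h f₁ f₂) c (0, ξ) : E × E →ₗ[ℝ] E × E) ∘ₗ
    LinearMap.inl ℝ E E

theorem horizontalShape_spec (hf₁ : 0 < f₁) (hf₂ : 0 < f₂) (ξ v w : E) :
    f₁ * h c.1 (horizontalShape h f₁ f₂ c ξ v) w = f₂ / 2 * h c.1 ξ (curvature h c.1 v w c.2) :=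
  H.sasakiForm_christoffel_vertical_fst hc hf₁ hf₂ ξ (v, 0) w

theorem horizontalShape_skew (hf₁ : 0 < f₁) (hf₂ : 0 < f₂) (ξ v w : E) :
    h c.1 (horizontalShape h f₁ f₂ c ξ v) w = - h c.1 (horizontalShape h f₁ f₂ c ξ w) v := by
  have h1 := H.horizontalShape_spec hc hf₁ hf₂ ξ v w
  have h2 := H.horizontalShape_spec hc hf₁ hf₂ ξ w v
  rw [curvature_antisymm, map_neg] at h2
  have : f₁ * (h c.1 (horizontalShape h f₁ f₂ c ξ v) w
      + h c.1 (horizontalShape h f₁ f₂ c ξ w) v) = 0 := by linear_combination h1 + h2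
  have := (mul_eq_zero.1 this).resolve_left hf₁.ne'
  linarith

/-- The endomorphism `∇ξ` kills vertical vectors. -/
theorem christoffel_vertical_eq_comp_fst (hf₁ : 0 < f₁) (hf₂ : 0 < f₂) (ξ : E) :
    (christoffel (sasakiForm h f₁ f₂) c (0, ξ) : E × E →ₗ[ℝ] E × E) =
      ((christoffel (sasakiForm h f₁ f₂) c (0, ξ) : E × E →ₗ[ℝ] E × E) ∘ₗ LinearMap.inl ℝ E E) ∘ₗ
        LinearMap.fst ℝ E E := by
  ext v : 2
  · simp
  · simp [H.sasakiForm_christoffel_vertical_vertical hc hf₁ hf₂]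

theorem trace_christoffel_vertical (hf₁ : 0 < f₁) (hf₂ : 0 < f₂) (ξ : E) :
    LinearMap.trace ℝ (E × E)
      (christoffel (sasakiForm h f₁ f₂) c (0, ξ) : E × E →ₗ[ℝ] E × E) = 0 := by
  rw [H.christoffel_vertical_eq_comp_fst hc hf₁ hf₂, LinearMap.trace_comp_comm']
  exact trace_eq_zero_of_skew ((ContinuousLinearMap.coeLM ℝ) ∘ₗ (h c.1 : E →ₗ[ℝ] E →L[ℝ] ℝ))
    (H.symm _ hc) (H.pos _ hc) (horizontalShape h f₁ f₂ c ξ)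
    (H.horizontalShape_skew hc hf₁ hf₂ ξ)

/-- The Ricci curvature of the weighted Sasaki metric in a vertical direction. -/
theorem ricci_sasakiForm_vertical (hf₁ : 0 < f₁) (hf₂ : 0 < f₂) (ξ : E) :
    ricci (sasakiForm h f₁ f₂) c (0, ξ) (0, ξ) =
      - LinearMap.trace ℝ E (horizontalShape h f₁ f₂ c ξ ∘ₗ horizontalShape h f₁ f₂ c ξ) := by
  have HG := H.isChartMetric_sasakiForm hf₁ hf₂
  have hcU : c ∈ U ×ˢ (Set.univ : Set E) := ⟨hc, Set.mem_univ _⟩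
  have hnear : ∀ᶠ c' in 𝓝 c, c'.1 ∈ U := (H.isOpen.preimage continuous_fst).mem_nhds hc
  set Γ := christoffel (sasakiForm h f₁ f₂) with hΓ
  set S : E × E →ₗ[ℝ] E × E := (Γ c (0, ξ)).toLinearMap with hS
  set D : E × E →L[ℝ] E × E := fderiv ℝ (fun c' => Γ c' (0, ξ)) c (0, ξ) with hD
  have hcurv : ∀ A, curvature (sasakiForm h f₁ f₂) c A (0, ξ) (0, ξ) = - (D A) - S (S A) := by
    intro A
    have h1 : (fun c' => Γ c' (0, ξ) (0, ξ)) =ᶠ[𝓝 c] fun _ => 0 :=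
      hnear.mono fun c' hc' => H.sasakiForm_christoffel_vertical_vertical hc' hf₁ hf₂ ξ ξ
    have h2 : (fun c' => Γ c' A (0, ξ)) =ᶠ[𝓝 c] fun c' => Γ c' (0, ξ) A :=
      hnear.mono fun c' hc' => HG.christoffel_symm ⟨hc', Set.mem_univ _⟩ _ _
    simp only [curvature, ← hΓ]
    rw [h1.fderiv_eq, h2.fderiv_eq, h1.eq_of_nhds, HG.fderiv_christoffel_apply hcU,
      h2.eq_of_nhds]
    simp [hS, hD, hΓ]
  have htrD : LinearMap.trace ℝ (E × E) (D : E × E →ₗ[ℝ] E × E) = 0 := by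
    let τ : (E × E →L[ℝ] E × E) →L[ℝ] ℝ := LinearMap.toContinuousLinearMap
      (LinearMap.trace ℝ (E × E) ∘ₗ ContinuousLinearMap.coeLM ℝ)
    have h1 : HasFDerivAt (fun c' => τ (Γ c' (0, ξ))) _ c :=
      τ.hasFDerivAt.comp c (HG.differentiableAt_christoffel hcU (0, ξ)).hasFDerivAt
    have h2 := h1.unique ((hasFDerivAt_const (0 : ℝ) c).congr_of_eventuallyEq
      (hnear.mono fun c' hc' => H.trace_christoffel_vertical hc' hf₁ hf₂ ξ))
    exact congrArg (fun L => L (0, ξ)) h2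
  -- `S` factors through the projection, so that the traces of `S²` and `T²` agree.
  have htrS : LinearMap.trace ℝ (E × E) (S ∘ₗ S) = LinearMap.trace ℝ E
      (horizontalShape h f₁ f₂ c ξ ∘ₗ horizontalShape h f₁ f₂ c ξ) := by
    have h1 : S = (S ∘ₗ LinearMap.inl ℝ E E) ∘ₗ LinearMap.fst ℝ E E :=
      H.christoffel_vertical_eq_comp_fst hc hf₁ hf₂ ξ
    have h2 : S ∘ₗ S = (S ∘ₗ LinearMap.inl ℝ E E) ∘ₗ
        (LinearMap.fst ℝ E E ∘ₗ S ∘ₗ LinearMap.inl ℝ E E ∘ₗ LinearMap.fst ℝ E E) := by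
      conv_lhs => rw [h1]
      rfl
    rw [h2, LinearMap.trace_comp_comm']
    rfl
  have htr : ∀ T : E × E →ₗ[ℝ] E × E, LinearMap.trace ℝ (E × E) T =
      ∑ i, (Module.finBasis ℝ (E × E)).coord i (T (Module.finBasis ℝ (E × E) i)) := by
    intro T
    rw [LinearMap.trace_eq_matrix_trace ℝ (Module.finBasis ℝ (E × E))]
    simp [Matrix.trace, LinearMap.toMatrix_apply]
  rw [htr] at htrD
  rw [← htrS, htr, ricci]
  simp only [hcurv, map_sub, map_neg, Finset.sum_sub_distrib, Finset.sum_neg_distrib]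
  rw [show ∑ i, (Module.finBasis ℝ (E × E)).coord i (D (Module.finBasis ℝ (E × E) i)) = 0 from htrD]
  simp

omit hc in
/-- A metric whose weighted Sasaki metric is Einstein is flat. -/
theorem curvature_eq_zero_of_ricci_sasakiForm (hf₁ : 0 < f₁) (hf₂ : 0 < f₂) {k : ℝ}
    (hric : ∀ c : E × E, c.1 ∈ U → ∀ A B,
      ricci (sasakiForm h f₁ f₂) c A B = k * sasakiForm h f₁ f₂ c A B)
    {y : E} (hy : y ∈ U) (v w z : E) : curvature h y v w z = 0 := by
  by_contra hne
  -- The vertical direction that detects a nonzero `R(v, w) z` is this vector itself.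
  set ξ := curvature h y v w z with hξ
  have hpos := H.pos y hy ξ hne
  have hv : ∀ η : E, k * (f₂ * h y ξ ξ) = - LinearMap.trace ℝ E
      (horizontalShape h f₁ f₂ (y, η) ξ ∘ₗ horizontalShape h f₁ f₂ (y, η) ξ) := by
    intro η
    rw [← H.ricci_sasakiForm_vertical (c := (y, η)) hy hf₁ hf₂, hric _ hy, sasakiForm_apply]
    simp [verticalPart_apply]
  -- On the zero section the right-hand side vanishes, hence so does the Einstein constant.
  have hshape0 : horizontalShape h f₁ f₂ (y, 0) ξ = 0 := by
    ext v
    refine H.ext_inner hy fun w => ?_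
    have := H.horizontalShape_spec (c := (y, 0)) hy hf₁ hf₂ ξ v w
    have h0 : curvature h y v w 0 = 0 := by simp [curvature]
    simp only [h0, map_zero, mul_zero] at this
    simpa using (mul_eq_zero.1 this).resolve_left hf₁.ne'
  have hk := hv 0
  rw [hshape0] at hk
  have hk0 : k * (f₂ * h y ξ ξ) = 0 := by simpa using hk
  -- Now take `z` as the fibre coordinate.
  have hz := hv z
  rw [hk0] at hz
  have hT := eq_zero_of_skew_of_trace_sq
    ((ContinuousLinearMap.coeLM ℝ) ∘ₗ (h y : E →ₗ[ℝ] E →L[ℝ] ℝ))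
    (H.symm _ hy) (H.pos _ hy) (horizontalShape h f₁ f₂ (y, z) ξ)
    (H.horizontalShape_skew (c := (y, z)) hy hf₁ hf₂ ξ) (by linarith)
  have := H.horizontalShape_spec (c := (y, z)) hy hf₁ hf₂ ξ v w
  rw [hT] at this
  simp only [LinearMap.zero_apply, map_zero, zero_apply, mul_zero, ← hξ] at this
  have : 0 < f₂ / 2 * h y ξ ξ := by positivity
  linarith

end IsChartMetric
end SasakiCurvature

/-! ### Expressions of a metric in the charts of a manifold -/

section Charts

open Filter Topology

variable {E : Type*} [NormedAddCommGroup E] [NormedSpace ℝ E]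
  {H : Type*} [TopologicalSpace H] {I : ModelWithCorners ℝ E H} [I.Boundaryless]
  {M : Type*} [TopologicalSpace M] [ChartedSpace H M]

/-- The differential of the inverse of the chart around `q`. Mathlib identifies the tangent space at
`x` with `E` by the preferred chart at `x`, so that this is the derivative of a transition map. -/
theorem mfderiv_extChartAt_symm_apply [IsManifold I 1 M] (q : M) {y : E}
    (hy : y ∈ (extChartAt I q).target) (v : E) :
    (mfderiv 𝓘(ℝ, E) I (extChartAt I q).symm y v : E) =
      tangentCoordChange I q ((extChartAt I q).symm y) ((extChartAt I q).symm y) v := by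
  have hx : (extChartAt I q).symm y ∈ (chartAt H q).source := by
    simpa using (extChartAt I q).map_target hy
  have h1 := TangentBundle.symmL_trivializationAt (𝕜 := ℝ) (I := I) hx
  rw [TangentBundle.symmL_trivializationAt_eq_core hx, I.range_eq_univ, mfderivWithin_univ] at h1
  have h2 := (extChartAt I q).right_inv hy
  have h3 : ∀ y', y' = y → (mfderiv 𝓘(ℝ, E) I (extChartAt I q).symm y v : E) =
      (mfderiv 𝓘(ℝ, E) I (extChartAt I q).symm y' v : E) := by
    rintro _ rfl; rfl
  rw [h3 _ h2]
  exact (congrArg (fun L : E →L[ℝ] E => L v) h1).symm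

theorem localMetric_extChartAt [IsManifold I 1 M]
    (g : ∀ x : M, TangentSpace I x →L[ℝ] TangentSpace I x →L[ℝ] ℝ) {q x : M}
    (hx : x ∈ (extChartAt I q).source) (v w : E) :
    localMetric I g q (extChartAt I q x) v w =
      g x (tangentCoordChange I q x x v : E) (tangentCoordChange I q x x w : E) := by
  obtain ⟨y, hy, rfl⟩ : ∃ y ∈ (extChartAt I q).target, (extChartAt I q).symm y = x :=
    ⟨_, (extChartAt I q).map_source hx, (extChartAt I q).left_inv hx⟩
  rw [(extChartAt I q).right_inv hy, localMetric_apply,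
    ← mfderiv_extChartAt_symm_apply q hy v, ← mfderiv_extChartAt_symm_apply q hy w]

theorem localMetric_eq [IsManifold I 1 M]
    (g : ∀ x : M, TangentSpace I x →L[ℝ] TangentSpace I x →L[ℝ] ℝ) {q : M} {y : E}
    (hy : y ∈ (extChartAt I q).target) (v w : E) :
    localMetric I g q y v w = g ((extChartAt I q).symm y)
      (tangentCoordChange I q ((extChartAt I q).symm y) ((extChartAt I q).symm y) v : E)
      (tangentCoordChange I q ((extChartAt I q).symm y) ((extChartAt I q).symm y) w : E) := by
  rw [localMetric_apply,
    ← mfderiv_extChartAt_symm_apply q hy v, ← mfderiv_extChartAt_symm_apply q hy w]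

variable (I) in
/-- The transition map from the chart around `q` to the chart around `q'`. -/
noncomputable def chartTransition (q q' : M) : E → E := extChartAt I q' ∘ (extChartAt I q).symm

variable {q q' : M} {y : E}

theorem eventually_mem_chartTransition_source (hy : y ∈ (extChartAt I q).target)
    (hy' : (extChartAt I q).symm y ∈ (extChartAt I q').source) :
    ∀ᶠ y' in 𝓝 y, y' ∈ (extChartAt I q).target ∧
      (extChartAt I q).symm y' ∈ (extChartAt I q').source := by
  have h1 := (isOpen_extChartAt_target (I := I) q).mem_nhds hy
  have h2 : ContinuousAt (extChartAt I q).symm y :=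
    (continuousOn_extChartAt_symm q).continuousAt h1
  exact (Filter.Eventually.and h1 (h2.preimage_mem_nhds
    ((isOpen_extChartAt_source (I := I) q').mem_nhds hy')))

theorem contDiffAt_chartTransition [IsManifold I ∞ M] (hy : y ∈ (extChartAt I q).target)
    (hy' : (extChartAt I q).symm y ∈ (extChartAt I q').source) :
    ContDiffAt ℝ ∞ (chartTransition I q q') y := by
  have := contDiffWithinAt_ext_coord_change (n := ∞) (I := I) q' q (y := y) ⟨hy, hy'⟩
  rwa [I.range_eq_univ, contDiffWithinAt_univ] at this

theorem tangentCoordChange_eq_fderiv [IsManifold I 1 M] (hy : y ∈ (extChartAt I q).target) :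
    tangentCoordChange I q q' ((extChartAt I q).symm y) = fderiv ℝ (chartTransition I q q') y := by
  rw [tangentCoordChange_def, I.range_eq_univ, fderivWithin_univ, (extChartAt I q).right_inv hy]
  rfl

theorem localMetric_chartTransition [IsManifold I ∞ M]
    (g : ∀ x : M, TangentSpace I x →L[ℝ] TangentSpace I x →L[ℝ] ℝ)
    (hy : y ∈ (extChartAt I q).target)
    (hy' : (extChartAt I q).symm y ∈ (extChartAt I q').source) (v w : E) :
    localMetric I g q y v w = localMetric I g q' (chartTransition I q q' y)
      (fderiv ℝ (chartTransition I q q') y v) (fderiv ℝ (chartTransition I q q') y w) := by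
  have hx := (extChartAt I q).map_target hy
  rw [localMetric_eq g hy, chartTransition, Function.comp_apply, localMetric_extChartAt g hy',
    ← chartTransition, ← tangentCoordChange_eq_fderiv hy, tangentCoordChange_comp,
    tangentCoordChange_comp]
  all_goals exact ⟨⟨hx, hy'⟩, mem_extChartAt_source _⟩

/-- The expressions of a smooth Riemannian metric in the charts of a manifold are smooth and
positive definite. -/
theorem isChartMetric_localMetric [FiniteDimensional ℝ E] [IsManifold I ∞ M]
    (g : ContMDiffRiemannianMetric I ∞ E (fun x : M => TangentSpace I x)) (q : M) :
    IsChartMetric (localMetric I g.inner q) (extChartAt I q).target where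
  isOpen := isOpen_extChartAt_target q
  contDiffOn := by
    refine contDiffOn_clm_apply.2 fun v => contDiffOn_clm_apply.2 fun w => ?_
    let e := trivializationAt E (TangentSpace I) q
    have hx : ∀ y ∈ (extChartAt I q).target, (extChartAt I q).symm y ∈ e.baseSet := fun y hy => by
      simpa [e] using (extChartAt I q).map_target hy
    have hsec : ∀ v : E, ContMDiffOn 𝓘(ℝ, E) (I.prod 𝓘(ℝ, E)) ∞
        (fun y => (⟨(extChartAt I q).symm y, e.symm ((extChartAt I q).symm y) v⟩ :
          TotalSpace E (TangentSpace I : M → Type _))) (extChartAt I q).target := by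
      intro v
      have h1 : ContMDiffOn 𝓘(ℝ, E) (I.prod 𝓘(ℝ, E)) ∞
          (fun y => ((extChartAt I q).symm y, v)) (extChartAt I q).target :=
        (contMDiffOn_extChartAt_symm q).prodMk contMDiffOn_const
      refine ((Trivialization.contMDiffOn_symm e).comp h1 fun y hy => ?_).congr fun y hy => ?_
      · exact e.mem_target.2 (hx y hy)
      · exact e.mk_symm (hx y hy) v
    rw [← contMDiffOn_iff_contDiffOn]
    intro y hy
    have hg : ContMDiffWithinAt 𝓘(ℝ, E) (I.prod 𝓘(ℝ, E →L[ℝ] E →L[ℝ] ℝ)) ∞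
        (fun y => TotalSpace.mk' (E →L[ℝ] E →L[ℝ] ℝ)
          (E := fun x : M => TangentSpace I x →L[ℝ] TangentSpace I x →L[ℝ] ℝ)
          ((extChartAt I q).symm y)
          (g.inner ((extChartAt I q).symm y))) (extChartAt I q).target y :=
      ContMDiffAt.comp_contMDiffWithinAt y g.contMDiff.contMDiffAt
        (contMDiffOn_extChartAt_symm q y hy)
    have h2 : ContMDiffWithinAt 𝓘(ℝ, E) (I.prod 𝓘(ℝ)) ∞
        (fun y => TotalSpace.mk' ℝ (E := Bundle.Trivial M ℝ) ((extChartAt I q).symm y)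
          (g.inner ((extChartAt I q).symm y) (e.symm ((extChartAt I q).symm y) v)
            (e.symm ((extChartAt I q).symm y) w))) (extChartAt I q).target y :=
      ContMDiffWithinAt.clm_bundle_apply₂ (F₁ := E) (F₂ := E) hg (hsec v y hy) (hsec w y hy)
    simp only [contMDiffWithinAt_totalSpace] at h2
    have hL : ∀ y ∈ (extChartAt I q).target, ∀ v : E,
        (tangentCoordChange I q ((extChartAt I q).symm y) ((extChartAt I q).symm y) v : E) =
          e.symm ((extChartAt I q).symm y) v := by
      intro y hy v
      have h3 : (extChartAt I q).symm y ∈ (chartAt H q).source := by simpa [e] using hx y hy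
      have h4 := congrArg (fun L : E →L[ℝ] E => L v)
        (TangentBundle.symmL_trivializationAt_eq_core (𝕜 := ℝ) (I := I) h3)
      exact h4.symm.trans (Trivialization.symmL_apply e (hx y hy) v)
    refine ContMDiffWithinAt.congr h2.2 (fun y hy => ?_) ?_
    · rw [localMetric_eq _ hy, hL y hy, hL y hy]; rfl
    · rw [localMetric_eq _ hy, hL y hy, hL y hy]; rfl
  symm y hy v w := by
    rw [localMetric_eq _ hy, localMetric_eq _ hy]
    exact g.symm _ _ _
  pos y hy v hv := by
    rw [localMetric_eq _ hy]
    refine g.pos _ _ fun h0 => hv ?_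
    have hx := (extChartAt I q).map_target hy
    have h1 := tangentCoordChange_comp (I := I) (w := q) (x := (extChartAt I q).symm y) (y := q)
      (v := v) ⟨⟨hx, mem_extChartAt_source _⟩, hx⟩
    rw [tangentCoordChange_self hx] at h1
    rw [← h1]
    exact (congrArg _ h0).trans (map_zero _)

end Charts

/-! ### The weighted Sasaki metric in the charts of the tangent bundle -/

section InducedCharts

open Filter Topology

variable {E : Type*} [NormedAddCommGroup E] [NormedSpace ℝ E]
  {H : Type*} [TopologicalSpace H] {I : ModelWithCorners ℝ E H} [I.Boundaryless]
  {M : Type*} [TopologicalSpace M] [ChartedSpace H M] [IsManifold I ∞ M]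

omit [I.Boundaryless] in
theorem mem_extChartAt_tangent_target {p : TangentBundle I M} {c : E × E} :
    c ∈ (extChartAt I.tangent p).target ↔ c.1 ∈ (extChartAt I p.proj).target := by
  rw [FiberBundle.extChartAt_target]
  simp only [Set.mem_prod, Set.mem_univ, and_true, Set.mem_inter_iff, Set.mem_preimage,
    and_iff_left_iff_imp]
  intro hc
  simpa using (extChartAt I p.proj).map_target hc

/-- The transition maps between the charts of the tangent bundle are the tangent maps of the
transition maps of `M`. -/
theorem extChartAt_tangent_transition {p p' : TangentBundle I M} {c : E × E}
    (hc : c.1 ∈ (extChartAt I p.proj).target)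
    (hc' : (extChartAt I p.proj).symm c.1 ∈ (extChartAt I p'.proj).source) :
    extChartAt I.tangent p' ((extChartAt I.tangent p).symm c) =
      (chartTransition I p.proj p'.proj c.1,
        fderiv ℝ (chartTransition I p.proj p'.proj) c.1 c.2) := by
  have hx := (extChartAt I p.proj).map_target hc
  rw [extChartAt_source] at hx hc'
  rw [FiberBundle.extChartAt, FiberBundle.extChartAt]
  have h1 := Trivialization.apply_symm_apply_eq_coordChangeL (R := ℝ)
    (trivializationAt E (TangentSpace I) p.proj) (trivializationAt E (TangentSpace I) p'.proj)
    (b := (extChartAt I p.proj).symm c.1) (by simpa using ⟨hx, hc'⟩) c.2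
  have h2 : Trivialization.coordChangeL ℝ (trivializationAt E (TangentSpace I) p.proj)
      (trivializationAt E (TangentSpace I) p'.proj) ((extChartAt I p.proj).symm c.1) c.2 =
        tangentCoordChange I p.proj p'.proj ((extChartAt I p.proj).symm c.1) c.2 :=
    VectorBundleCore.localTriv_coordChange_eq (tangentBundleCore I M) (achart H p.proj)
      (achart H p'.proj) ⟨hx, hc'⟩ c.2
  rw [h2, tangentCoordChange_eq_fderiv hc] at h1
  exact congrArg (Prod.map (extChartAt I p'.proj) id) h1

variable {p : TangentBundle I M} {c : E × E} (hc : c.1 ∈ (extChartAt I p.proj).target)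
include hc

theorem mdifferentiableAt_extChartAt_tangent_symm :
    MDifferentiableAt 𝓘(ℝ, E × E) I.tangent (extChartAt I.tangent p).symm c := by
  have := mdifferentiableWithinAt_extChartAt_symm (I := I.tangent)
    (mem_extChartAt_tangent_target.2 hc)
  rwa [I.tangent.range_eq_univ, mdifferentiableWithinAt_univ] at this

theorem dProj_mfderiv_extChartAt_symm (A : E × E) :
    (dProj I ((extChartAt I.tangent p).symm c)
      (mfderiv 𝓘(ℝ, E × E) I.tangent (extChartAt I.tangent p).symm c A) : E) =
      tangentCoordChange I p.proj ((extChartAt I p.proj).symm c.1)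
        ((extChartAt I p.proj).symm c.1) A.1 := by
  have h1 := mfderiv_comp_apply c
    (mdifferentiableAt_proj (𝕜 := ℝ) (IB := I) (TangentSpace I : M → Type _))
    (mdifferentiableAt_extChartAt_tangent_symm hc) A
  have h2 : MDifferentiableAt 𝓘(ℝ, E) I (extChartAt I p.proj).symm c.1 := by
    have := mdifferentiableWithinAt_extChartAt_symm (I := I) hc
    rwa [I.range_eq_univ, mdifferentiableWithinAt_univ] at this
  have h3 : MDifferentiableAt 𝓘(ℝ, E × E) 𝓘(ℝ, E) (Prod.fst : E × E → E) c :=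
    differentiableAt_fst.mdifferentiableAt
  have h4 := mfderiv_comp_apply c h2 h3 A
  rw [← mfderiv_extChartAt_symm_apply p.proj hc]
  refine h1.symm.trans (h4.trans ?_)
  rw [mfderiv_eq_fderiv, fderiv_fst]
  rfl

/-- The connection map is given in all the charts of the tangent bundle by the same formula. -/
theorem connectionMap_mfderiv_extChartAt_symm [FiniteDimensional ℝ E]
    (g : ContMDiffRiemannianMetric I ∞ E (fun x : M => TangentSpace I x)) (A : E × E) :
    (connectionMap I g.inner ((extChartAt I.tangent p).symm c)
      (mfderiv 𝓘(ℝ, E × E) I.tangent (extChartAt I.tangent p).symm c A) : E) =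
      tangentCoordChange I p.proj ((extChartAt I p.proj).symm c.1)
        ((extChartAt I p.proj).symm c.1) (verticalPart (localMetric I g.inner p.proj) c A) := by
  set z := (extChartAt I.tangent p).symm c with hz
  have hzp : z.proj = (extChartAt I p.proj).symm c.1 := rfl
  set φ := chartTransition I p.proj z.proj with hφ
  have hzs : (extChartAt I p.proj).symm c.1 ∈ (extChartAt I z.proj).source :=
    mem_extChartAt_source _
  have hφd : ContDiffAt ℝ ∞ φ c.1 := contDiffAt_chartTransition hc hzs
  have hφ1 : HasFDerivAt φ (fderiv ℝ φ c.1) c.1 := (hφd.differentiableAt (by simp)).hasFDerivAt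
  have hφ2 : HasFDerivAt (fderiv ℝ φ) (fderiv ℝ (fderiv ℝ φ) c.1) c.1 :=
    ((hφd.fderiv_right (m := ∞) (by simp)).differentiableAt (by simp)).hasFDerivAt
  have hsymm : IsSymmSndFDerivAt ℝ φ c.1 := isSymmSndFDerivAt_of_contDiffAt_infty hφd
  -- The components of the tangent vector in the chart around `z`.
  have hcomp : (mfderiv I.tangent 𝓘(ℝ, E × E) (extChartAt I.tangent z) z
      (mfderiv 𝓘(ℝ, E × E) I.tangent (extChartAt I.tangent p).symm c A) : E × E) =
      (fderiv ℝ φ c.1 A.1, fderiv ℝ (fderiv ℝ φ) c.1 A.1 c.2 + fderiv ℝ φ c.1 A.2) := by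
    have h1 := mfderiv_comp_apply c (mdifferentiableAt_extChartAt (I := I.tangent) (x := z)
      (mem_chart_source _ z)) (mdifferentiableAt_extChartAt_tangent_symm hc) A
    have h2 : (extChartAt I.tangent z ∘ (extChartAt I.tangent p).symm) =ᶠ[𝓝 c]
        fun c' => (φ c'.1, fderiv ℝ φ c'.1 c'.2) := by
      have := (continuous_fst.tendsto c).eventually (eventually_mem_chartTransition_source hc hzs)
      exact this.mono fun c' hc' => extChartAt_tangent_transition hc'.1 hc'.2
    have h3 : HasFDerivAt (fun c' : E × E => (φ c'.1, fderiv ℝ φ c'.1 c'.2)) _ c :=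
      (HasFDerivAt.comp c hφ1 hasFDerivAt_fst).prodMk
        ((HasFDerivAt.comp c hφ2 hasFDerivAt_fst).clm_apply hasFDerivAt_snd)
    rw [mfderiv_eq_fderiv, h2.fderiv_eq, h3.fderiv] at h1
    exact h1.symm.trans (Prod.ext rfl (add_comm _ _))
  have hcoord : extChartAt I.tangent z z = (φ c.1, fderiv ℝ φ c.1 c.2) :=
    extChartAt_tangent_transition hc hzs
  have hchr := christoffel_changeOfCharts (isChartMetric_localMetric g p.proj)
    (isChartMetric_localMetric g z.proj) hc (φ := φ) ((extChartAt I z.proj).map_source hzs) hφd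
    ((eventually_mem_chartTransition_source hc hzs).mono fun y' hy' v w =>
      localMetric_chartTransition g.inner hy'.1 hy'.2 v w) c.2 A.1
  have hself : ∀ v : E,
      ((trivializationAt E (TangentSpace I) z.proj).symmL ℝ z.proj v : E) = v := by
    intro v
    have h4 := congrArg (fun L : E →L[ℝ] E => L v)
      (TangentBundle.symmL_trivializationAt_eq_core (𝕜 := ℝ) (I := I) (mem_chart_source H z.proj))
    exact h4.trans (tangentCoordChange_self (mem_extChartAt_source z.proj))
  have hmain : (connectionMap I g.inner z
      (mfderiv 𝓘(ℝ, E × E) I.tangent (extChartAt I.tangent p).symm c A) : E) =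
      fderiv ℝ (fderiv ℝ φ) c.1 A.1 c.2 + fderiv ℝ φ c.1 A.2
        + christoffel (localMetric I g.inner z.proj) (φ c.1) (fderiv ℝ φ c.1 c.2)
          (fderiv ℝ φ c.1 A.1) := by
    refine (hself _).trans ?_
    change (mfderiv I.tangent 𝓘(ℝ, E × E) (extChartAt I.tangent z) z
      (mfderiv 𝓘(ℝ, E × E) I.tangent (extChartAt I.tangent p).symm c A) : E × E).2
      + christoffel (localMetric I g.inner z.proj) (extChartAt I.tangent z z).1
        (extChartAt I.tangent z z).2 (mfderiv I.tangent 𝓘(ℝ, E × E) (extChartAt I.tangent z) z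
      (mfderiv 𝓘(ℝ, E × E) I.tangent (extChartAt I.tangent p).symm c A) : E × E).1 = _
    rw [hcomp, hcoord]
  rw [hmain, tangentCoordChange_eq_fderiv hc, verticalPart_apply, map_add, ← hzp, ← hφ, hchr,
    hsymm.eq c.2 A.1]
  abel

/-- In the charts of the tangent bundle, the weighted Sasaki metric is `sasakiForm`. -/
theorem localMetric_weightedSasaki [FiniteDimensional ℝ E]
    (g : ContMDiffRiemannianMetric I ∞ E (fun x : M => TangentSpace I x)) (f₁ f₂ : ℝ) :
    localMetric I.tangent (weightedSasaki I g.inner f₁ f₂) p c =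
      sasakiForm (localMetric I g.inner p.proj) f₁ f₂ c := by
  refine ContinuousLinearMap.ext fun A => ContinuousLinearMap.ext fun B => ?_
  rw [localMetric_apply, weightedSasaki_apply, sasakiForm_apply, localMetric_eq _ hc,
    localMetric_eq _ hc, ← dProj_mfderiv_extChartAt_symm hc, ← dProj_mfderiv_extChartAt_symm hc,
    ← connectionMap_mfderiv_extChartAt_symm hc, ← connectionMap_mfderiv_extChartAt_symm hc]
  rfl

end InducedCharts

/-! ### Flat and Einstein metrics -/

section Einstein

open Filter Topology

variable {E : Type*} [NormedAddCommGroup E] [NormedSpace ℝ E] [FiniteDimensional ℝ E]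
  {H : Type*} [TopologicalSpace H] {I : ModelWithCorners ℝ E H} [I.Boundaryless]
  {M : Type*} [TopologicalSpace M] [ChartedSpace H M] [IsManifold I ∞ M]
  (g : ContMDiffRiemannianMetric I ∞ E (fun x : M => TangentSpace I x)) {f₁ f₂ : ℝ}

omit [FiniteDimensional ℝ E] [I.Boundaryless] in
theorem IsFlat.isEinstein {N : Type*} [FiniteDimensional ℝ E] [TopologicalSpace N]
    [ChartedSpace H N] {g : ∀ x : N, TangentSpace I x →L[ℝ] TangentSpace I x →L[ℝ] ℝ}
    (hg : IsFlat I g) : IsEinstein I g :=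
  ⟨0, fun q y hy v w => by simp [ricci, hg q y hy]⟩

theorem localMetric_weightedSasaki_eventuallyEq (p : TangentBundle I M) {c : E × E}
    (hc : c.1 ∈ (extChartAt I p.proj).target) :
    localMetric I.tangent (weightedSasaki I g.inner f₁ f₂) p =ᶠ[𝓝 c]
      sasakiForm (localMetric I g.inner p.proj) f₁ f₂ := by
  filter_upwards [((isOpen_extChartAt_target p.proj).preimage continuous_fst).mem_nhds hc]
    with c' hc'
  exact localMetric_weightedSasaki hc' g f₁ f₂

theorem isFlat_weightedSasaki (hf₁ : 0 < f₁) (hf₂ : 0 < f₂) (hg : IsFlat I g.inner) :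
    IsFlat I.tangent (weightedSasaki I g.inner f₁ f₂) := by
  intro p c hc A B Z
  rw [mem_extChartAt_tangent_target] at hc
  rw [curvature_congr (localMetric_weightedSasaki_eventuallyEq g p hc)]
  exact (isChartMetric_localMetric g p.proj).curvature_sasakiForm_eq_zero hf₁ hf₂ (hg p.proj) hc
    A B Z

theorem isFlat_of_isEinstein_weightedSasaki (hf₁ : 0 < f₁) (hf₂ : 0 < f₂)
    (hG : IsEinstein I.tangent (weightedSasaki I g.inner f₁ f₂)) : IsFlat I g.inner := by
  obtain ⟨k, hk⟩ := hG
  intro q y hy v w z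
  refine (isChartMetric_localMetric g q).curvature_eq_zero_of_ricci_sasakiForm hf₁ hf₂ (k := k)
    (fun c hc A B => ?_) hy v w z
  have h1 := hk (⟨q, (0 : E)⟩ : TangentBundle I M) c (mem_extChartAt_tangent_target.2 hc) A B
  rw [localMetric_weightedSasaki (p := (⟨q, (0 : E)⟩ : TangentBundle I M)) hc g f₁ f₂] at h1
  rw [← h1]
  simp only [ricci, curvature_congr
    (localMetric_weightedSasaki_eventuallyEq g (⟨q, (0 : E)⟩ : TangentBundle I M) hc)]

end Einstein

end TangentBundleMetric

theorem proposition1p3 {m : ℕ} {M : Type*} [TopologicalSpace M]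
    [ChartedSpace (EuclideanSpace ℝ (Fin m)) M] [IsManifold (𝓡 m) ∞ M]
    (g : ContMDiffRiemannianMetric (𝓡 m) ∞ (EuclideanSpace ℝ (Fin m))
      (fun x : M => TangentSpace (𝓡 m) x))
    (f₁ f₂ : ℝ) (hf₁ : 0 < f₁) (hf₂ : 0 < f₂) :
    (TangentBundleMetric.IsEinstein (𝓡 m).tangent
        (TangentBundleMetric.weightedSasaki (𝓡 m) g.inner f₁ f₂) ↔
      TangentBundleMetric.IsFlat (𝓡 m).tangent
        (TangentBundleMetric.weightedSasaki (𝓡 m) g.inner f₁ f₂)) ∧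
    (TangentBundleMetric.IsFlat (𝓡 m).tangent
        (TangentBundleMetric.weightedSasaki (𝓡 m) g.inner f₁ f₂) ↔
      TangentBundleMetric.IsFlat (𝓡 m) g.inner) := by
  have h1 := TangentBundleMetric.isFlat_of_isEinstein_weightedSasaki g hf₁ hf₂
  have h2 := TangentBundleMetric.isFlat_weightedSasaki g hf₁ hf₂
  exact ⟨⟨fun h => h2 (h1 h), fun h => h.isEinstein⟩, ⟨fun h => h1 h.isEinstein, h2⟩⟩
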